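/- \textbf{Setting.} Let $(\Omega,\mathcal F,P)$ be a complete probability space, $B\subset(0,\infty)$ a Borel set, $G$ a probability measure on $B$, $\beta>0$, and let $\mu(dt\,dy)$ be a Poisson random measure on $\mathbb R_+\times B$ with intensity (compensator) $dt\,\beta G(dy)$. Let $(\mathcal F_t)_{t\ge 0}$ be the natural filtration of $\mu$, completed by the $P$-null sets, and let $Y$ be a random variable with law $G$. Let $f:\mathbb R_+\times\mathbb R\to\mathbb R_+$ be continuous and such that: for every $y\ge 0$ the function $f(\cdot,y)$ is convex, non-decreasing, Lipschitz with a constant $K_0$ that does not depend on $y$, and $f(0,y)=0$; for every $x\geq 0$ the function $f(x,\cdot)$ is non-decreasing and $f(x,0)=0$; and $f(x,y)>0$ whenever $x>0$ and $y>0$. For $x<0$ and $y\ge 0$ we put $f(x,y)=0$. Let $0\le k_1<k_2$ and $\zeta_0>0$ be real constants, and set \[ \nu=E[f(1,Y)],\qquad a=\frac1{\zeta_0\nu},\qquad p(v)=(1+k_1)\beta\nu-(1+k_2)\beta E\big[f(1,(Y-v)^+)\big]. \] Let $\underline u>0$ be such that $p(v)\ge \beta E[f(1,Y\wedge v)]$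 for all $v\ge\underline u$. Assume that $aK_0\le 1$. \textbf{Proposition (comparison).} Let $u$ be an $(\mathcal F_t)$-adapted real process with $u_t\ge\underline u$ for all $t\geq 0$, and let $l$ be an $(\mathcal F_t)$-adapted, c\`adl\`ag, non-decreasing process with $l_{0-}=0$ (a jump at time $0$ is allowed). Let $0\le x\le x'$, and let $X^{x,u,l}$ and $X^{x',u,l}$ be adapted c\`adl\`ag solutions, started from $x$ and from $x'$ respectively, of \[ X_t=x+a\int_0^t X_s\,p(u_s)\,ds-\int_0^{t+}\!\!\int_B f\big(aX_{s-},\,y\wedge u_s\big)\,\mu(ds\,dy)-\int_0^t dl_s ,\qquad t\ge 0 \] (all integrals being defined pathwise; the last one equals $l_t$). Then, almost surely, $X^{x,u,l}_t\le X^{x',u,l}_t$ for all $t\ge 0$. -/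

import Mathlib

open MeasureTheory ProbabilityTheory Filter Topology
open scoped NNReal ENNReal

noncomputable section

namespace Reinsurance

/-- A right-continuous path on `[0, ∞)` with (finite) left limits. -/
structure IsCadlag (x : ℝ≥0 → ℝ) : Prop where
  rightCts : ∀ t, ContinuousWithinAt x (Set.Ici t) t
  leftLim : ∀ t, ∃ b, Tendsto x (𝓝[<] t) (𝓝 b)

/-- `μ` is a Poisson random measure on `E` with intensity measure `Λ`: a random measure with values
in `ℕ ∪ {∞}`, Poisson distributed with mean `Λ A` on each measurable `A` with `Λ A < ∞`, and
independent on disjoint measurable sets. -/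
structure IsPoissonRandomMeasure {Ω E : Type*} [MeasurableSpace Ω] [MeasurableSpace E]
    (P : Measure Ω) (μ : Ω → Measure E) (Λ : Measure E) : Prop where
  measurable : Measurable μ
  integerValued : ∀ ω A, MeasurableSet A → ∃ n : ℕ∞, μ ω A = (n : ℝ≥0∞)
  law : ∀ A, MeasurableSet A → Λ A ≠ ∞ →
    P.map (fun ω => μ ω A) =
      (poissonMeasure (Λ A).toNNReal).map (fun n : ℕ => (n : ℝ≥0∞))
  indep : ∀ (n : ℕ) (A : Fin n → Set E), (∀ i, MeasurableSet (A i)) →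
    Pairwise (fun i j => Disjoint (A i) (A j)) → iIndepFun (fun i ω => μ ω (A i)) P

/-- Lebesgue measure on `[0, ∞)`. -/
def lebesgue : Measure ℝ≥0 :=
  (volume : Measure ℝ).comap (fun t : ℝ≥0 => (t : ℝ))

/-- The intensity `dt ⊗ β G(dy)` of the claims, on `[0, ∞) × ℝ` (the law `G` of a claim size is
carried by a Borel set `B ⊆ (0, ∞)`). -/
def claimIntensity (β : ℝ≥0) (G : Measure ℝ) : Measure (ℝ≥0 × ℝ) :=
  lebesgue.prod (β • G)

theorem measurable_restrict_measure {E : Type*} [MeasurableSpace E] {A : Set E}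
    (hA : MeasurableSet A) : Measurable (fun m : Measure E => m.restrict A) := by
  refine Measure.measurable_of_measurable_coe _ fun s hs => ?_
  simp only [Measure.restrict_apply hs]
  exact Measure.measurable_coe (hs.inter hA)

/-- The natural filtration of the random measure `μ`, completed by the `P`-null sets:
at time `t` it is generated by the restriction of `μ` to `[0, t] × ℝ` and by the null sets. -/
def naturalFiltration {Ω : Type*} [mΩ : MeasurableSpace Ω] (P : Measure Ω) [P.IsComplete]
    (μ : Ω → Measure (ℝ≥0 × ℝ)) (hμ : Measurable μ) : Filtration ℝ≥0 mΩ where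
  seq t := MeasurableSpace.comap (fun ω => (μ ω).restrict (Set.Iic t ×ˢ Set.univ)) inferInstance ⊔
    MeasurableSpace.generateFrom {N | P N = 0}
  mono' := by
    intro s t hst
    refine sup_le_sup_right ?_ _
    have hm : MeasurableSet (Set.Iic s ×ˢ (Set.univ : Set ℝ)) :=
      measurableSet_Iic.prod MeasurableSet.univ
    have h : (fun ω => (μ ω).restrict (Set.Iic s ×ˢ Set.univ)) =
        (fun m : Measure (ℝ≥0 × ℝ) => m.restrict (Set.Iic s ×ˢ Set.univ)) ∘
          (fun ω => (μ ω).restrict (Set.Iic t ×ˢ Set.univ)) := by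
      funext ω
      simp only [Function.comp]
      rw [Measure.restrict_restrict hm, Set.inter_eq_left.mpr]
      exact Set.prod_mono (Set.Iic_subset_Iic.mpr hst) le_rfl
    rw [h, ← MeasurableSpace.comap_comp]
    exact MeasurableSpace.comap_mono (measurable_restrict_measure hm).comap_le
  le' := by
    intro t
    have hm : MeasurableSet (Set.Iic t ×ˢ (Set.univ : Set ℝ)) :=
      measurableSet_Iic.prod MeasurableSet.univ
    refine sup_le ((measurable_restrict_measure hm).comp hμ).comap_le ?_
    exact MeasurableSpace.generateFrom_le fun N hN => measurableSet_of_null hN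

/-- The assumptions on the claim function `f : ℝ₊ × ℝ → ℝ₊` (number of contracts, risk), with
Lipschitz constant `K₀` in the first variable. -/
structure IsClaimFunction (f : ℝ≥0 → ℝ → ℝ≥0) (K₀ : ℝ≥0) : Prop where
  convex : ∀ y, 0 ≤ y → ConvexOn ℝ≥0 Set.univ (fun x => f x y)
  mono_left : ∀ y, 0 ≤ y → Monotone (fun x => f x y)
  zero_left : ∀ y, 0 ≤ y → f 0 y = 0
  mono_right : ∀ x, Monotone (f x)
  zero_right : ∀ x, f x 0 = 0
  pos : ∀ x y, 0 < x → 0 < y → 0 < f x y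
  continuous : Continuous (fun z : ℝ≥0 × ℝ => f z.1 z.2)
  lipschitz : ∀ y, 0 ≤ y → LipschitzWith K₀ (fun x => f x y)

/-- `ν = E[f(1, Y)]`, where `Y` has law `G`. -/
def meanClaim (G : Measure ℝ) (f : ℝ≥0 → ℝ → ℝ≥0) : ℝ :=
  ∫ y, (f 1 y : ℝ) ∂G

/-- The premium rate per contract
`p(v) = (1 + k₁) β ν - (1 + k₂) β E[f(1, (Y - v)⁺)]` at the retention level `v`. -/
def premiumRate (β : ℝ≥0) (G : Measure ℝ) (f : ℝ≥0 → ℝ → ℝ≥0) (k₁ k₂ v : ℝ) : ℝ :=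
  (1 + k₁) * β * meanClaim G f - (1 + k₂) * β * ∫ y, (f 1 (max (y - v) 0) : ℝ) ∂G

/-- `v₀` is a minimal retention level: `v₀ > 0` and, at every level `v ≥ v₀`, the premium covers the
expected expenditures, `p(v) ≥ β E[f(1, Y ∧ v)]`. -/
def IsMinimalRetention (β : ℝ≥0) (G : Measure ℝ) (f : ℝ≥0 → ℝ → ℝ≥0) (k₁ k₂ v₀ : ℝ) : Prop :=
  0 < v₀ ∧ ∀ v, v₀ ≤ v → β * ∫ y, (f 1 (min y v) : ℝ) ∂G ≤ premiumRate β G f k₁ k₂ v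

/-- The maximal number of contracts per unit of fortune, `a = 1 / (ζ₀ ν)`. -/
def contractRatio (ζ₀ : ℝ) (G : Measure ℝ) (f : ℝ≥0 → ℝ → ℝ≥0) : ℝ :=
  1 / (ζ₀ * meanClaim G f)

/-- A retention process: adapted, with `u_t ≥ v₀` for all `t`, almost surely. -/
structure IsRetention {Ω : Type*} [mΩ : MeasurableSpace Ω] (P : Measure Ω)
    (𝓕 : Filtration ℝ≥0 mΩ) (v₀ : ℝ) (u : ℝ≥0 → Ω → ℝ) : Prop where
  adapted : Adapted 𝓕 u
  ge : ∀ᵐ ω ∂P, ∀ t, v₀ ≤ u t ω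

/-- A cumulative payment process: adapted, càdlàg, non-decreasing, with `l_{0-} = 0`. A jump at
time `0` is allowed, so that the convention `l_{0-} = 0` amounts to `l_0 ≥ 0`. -/
structure IsCumulative {Ω : Type*} [mΩ : MeasurableSpace Ω] (P : Measure Ω)
    (𝓕 : Filtration ℝ≥0 mΩ) (l : ℝ≥0 → Ω → ℝ) : Prop where
  adapted : Adapted 𝓕 l
  cadlag : ∀ᵐ ω ∂P, IsCadlag (fun t => l t ω)
  mono : ∀ᵐ ω ∂P, Monotone (fun t => l t ω)
  nonneg : ∀ᵐ ω ∂P, 0 ≤ l 0 ω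

/-- The claim `f(a X_{s-}, y ∧ u_s)` paid for a claim of size `z.2 = y` at time `z.1 = s`, along the
paths `X` and `u`. The function `f(·, y)` is extended by `f(0, y) = 0` to the negative axis (the only
non-negative non-decreasing extension), since `X` may become negative. -/
def claimSize (a : ℝ) (f : ℝ≥0 → ℝ → ℝ≥0) (X u : ℝ≥0 → ℝ) (z : ℝ≥0 × ℝ) : ℝ :=
  f (a * Function.leftLim X z.1).toNNReal (min z.2 (u z.1))

/-- `X` is an adapted càdlàg solution of
`X_t = x + a ∫₀ᵗ X_s p(u_s) ds - ∫₀^{t+} ∫_B f(a X_{s-}, y ∧ u_s) μ(ds dy) - ∫₀ᵗ dl_s`.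
Both integrals are required to exist, and the last one is `l_t - l_{0-} = l_t`. -/
structure IsSolution {Ω : Type*} [mΩ : MeasurableSpace Ω] (P : Measure Ω)
    (𝓕 : Filtration ℝ≥0 mΩ) (μ : Ω → Measure (ℝ≥0 × ℝ)) (B : Set ℝ) (f : ℝ≥0 → ℝ → ℝ≥0)
    (p : ℝ → ℝ) (a x : ℝ) (u l X : ℝ≥0 → Ω → ℝ) : Prop where
  adapted : Adapted 𝓕 X
  cadlag : ∀ᵐ ω ∂P, IsCadlag (fun t => X t ω)
  integrable_premium : ∀ᵐ ω ∂P, ∀ t,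
    IntegrableOn (fun s => X s ω * p (u s ω)) (Set.Icc 0 t) lebesgue
  integrable_claims : ∀ᵐ ω ∂P, ∀ t,
    IntegrableOn (claimSize a f (fun s => X s ω) (fun s => u s ω)) (Set.Ioc 0 t ×ˢ B) (μ ω)
  equation : ∀ᵐ ω ∂P, ∀ t,
    X t ω = x + a * (∫ s in Set.Icc 0 t, X s ω * p (u s ω) ∂lebesgue)
      - (∫ z in Set.Ioc 0 t ×ˢ B, claimSize a f (fun s => X s ω) (fun s => u s ω) z ∂(μ ω))
      - l t ω

end Reinsurance

end

namespace Reinsurance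

/-! The argument is pathwise. In the difference `D = X' - X` the payments `l` cancel, so `D` starts
from `x' - x ≥ 0`, grows at rate `a * D * p(u)` between claims, and drops at a claim by `f(aX'₋, ·)
- f(aX₋, ·)`. The growth cannot change the sign of `D`. If `D₋ ≥ 0`, the Lipschitz bound and `a * K₀
≤ 1` make the drop at most `a * K₀ * D₋ ≤ D₋`, so a single claim cannot make `D` negative either
(`IsClaimFunction.sub_le`).

It remains that claims are almost surely finite in number on bounded intervals and never
simultaneous; two simultaneous claims could together exceed `D₋`. Both facts come from the Poisson
law. The deterministic core is `nonneg_of_linear_of_jump_le`: at the infimum `τ` of the times where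
`D < 0`, the jump bound gives `D τ ≥ 0`, and a contraction estimate on a claim-free interval after
`τ` keeps `D ≥ 0` there, a contradiction. -/

theorem lebesgue_apply (s : Set ℝ≥0) : lebesgue s = volume ((fun t : ℝ≥0 => (t : ℝ)) '' s) :=
  (MeasurableEmbedding.subtype_coe (measurableSet_Ici (a := (0 : ℝ)))).comap_apply _ _

theorem lebesgue_Ioc (s t : ℝ≥0) : lebesgue (Set.Ioc s t) = ENNReal.ofReal ((t : ℝ) - s) := by
  rw [lebesgue_apply, ← Real.volume_Ioc]
  congr 1
  ext r
  simp only [Set.mem_image, Set.mem_Ioc]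
  constructor
  · rintro ⟨x, hx, rfl⟩
    exact_mod_cast hx
  · intro hr
    exact ⟨⟨r, s.2.trans hr.1.le⟩, ⟨NNReal.coe_lt_coe.1 hr.1, NNReal.coe_le_coe.1 hr.2⟩, rfl⟩

theorem lebesgue_singleton (s : ℝ≥0) : lebesgue {s} = 0 := by
  rw [lebesgue_apply]
  simp

theorem measure_eq_zero_of_lt_one {E : Type*} [MeasurableSpace E] {m : Measure E} {A : Set E}
    (hm : ∃ n : ℕ∞, m A = (n : ℝ≥0∞)) (h : m A < 1) : m A = 0 := by
  obtain ⟨n, hn⟩ := hm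
  rw [hn] at h ⊢
  have h1 : n < 1 := by exact_mod_cast h
  rw [Order.lt_one_iff] at h1
  simp [h1]

/-! ### Deterministic analysis of one path -/

section Path

variable {m : Measure (ℝ≥0 × ℝ)} {B : Set ℝ}

/-- The strips shrink to the empty set as `r ↓ τ` and have finite mass, so their mass tends to `0`;
being an integer, it is eventually equal to `0`. -/
theorem exists_gt_measure_Ioc_prod_eq_zero (hB : MeasurableSet B)
    (hint : ∀ A, MeasurableSet A → ∃ n : ℕ∞, m A = (n : ℝ≥0∞))
    (hfin : ∀ t, m (Set.Ioc 0 t ×ˢ B) ≠ ∞) (τ : ℝ≥0) :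
    ∃ r, τ < r ∧ m (Set.Ioc τ r ×ˢ B) = 0 := by
  have hlim := tendsto_measure_biInter_gt (μ := m) (s := fun r => Set.Ioc τ r ×ˢ B) (a := τ)
    (fun r _ => (measurableSet_Ioc.prod hB).nullMeasurableSet)
    (fun i j _ hij => Set.prod_mono (Set.Ioc_subset_Ioc_right hij) le_rfl)
    ⟨τ + 1, lt_add_one τ, ne_top_of_le_ne_top (hfin (τ + 1))
      (measure_mono (Set.prod_mono (Set.Ioc_subset_Ioc_left zero_le) le_rfl))⟩
  have hempty : (⋂ r > τ, Set.Ioc τ r ×ˢ B) = ∅ := by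
    refine Set.eq_empty_of_forall_notMem fun z hz => ?_
    simp only [Set.mem_iInter] at hz
    have h1 := (hz (τ + 1) (lt_add_one τ)).1.1
    obtain ⟨r, hr1, hr2⟩ := exists_between h1
    exact absurd (hz r hr1).1.2 (not_le.2 hr2)
  rw [hempty, measure_empty] at hlim
  have hev := (hlim.eventually_lt_const one_pos).and self_mem_nhdsWithin
  obtain ⟨r, hr1, hr2⟩ := hev.exists
  exact ⟨r, hr2, measure_eq_zero_of_lt_one (hint _ (measurableSet_Ioc.prod hB)) hr1⟩

/-- The left-hand counterpart. The interval is open at `τ` because a claim may occur at `τ` itself.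
-/
theorem exists_lt_measure_Ioo_prod_eq_zero (hB : MeasurableSet B)
    (hint : ∀ A, MeasurableSet A → ∃ n : ℕ∞, m A = (n : ℝ≥0∞))
    (hfin : ∀ t, m (Set.Ioc 0 t ×ˢ B) ≠ ∞) {τ : ℝ≥0} (hτ : 0 < τ) :
    ∃ r, r < τ ∧ m (Set.Ioo r τ ×ˢ B) = 0 := by
  obtain ⟨v, hv, hvlt, hvlim⟩ := exists_seq_strictMono_tendsto' hτ
  have hlim := tendsto_measure_iInter_atTop (μ := m) (s := fun n => Set.Ioo (v n) τ ×ˢ B)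
    (fun n => (measurableSet_Ioo.prod hB).nullMeasurableSet)
    (fun i j hij => Set.prod_mono (Set.Ioo_subset_Ioo_left (hv.monotone hij)) le_rfl)
    ⟨0, ne_top_of_le_ne_top (hfin τ) (measure_mono (Set.prod_mono
      ((Set.Ioo_subset_Ioo_left zero_le).trans Set.Ioo_subset_Ioc_self) le_rfl))⟩
  have hempty : (⋂ n, Set.Ioo (v n) τ ×ˢ B) = ∅ := by
    refine Set.eq_empty_of_forall_notMem fun z hz => ?_
    simp only [Set.mem_iInter] at hz
    exact absurd (le_of_tendsto' hvlim fun n => (hz n).1.1.le) (not_le.2 (hz 0).1.2)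
  rw [hempty, measure_empty] at hlim
  obtain ⟨n, hn⟩ := (hlim.eventually_lt_const one_pos).exists
  exact ⟨v n, (hvlt n).2, measure_eq_zero_of_lt_one (hint _ (measurableSet_Ioo.prod hB)) hn⟩

/-- Positivity of the solution of a linear equation with downward jumps that are isolated, simple
and, from a nonnegative level, no larger than that level. -/
theorem nonneg_of_linear_of_jump_le (hB : MeasurableSet B)
    (hint : ∀ A, MeasurableSet A → ∃ n : ℕ∞, m A = (n : ℝ≥0∞))
    (hfin : ∀ t, m (Set.Ioc 0 t ×ˢ B) ≠ ∞) (hsimple : ∀ t, 0 < t → m ({t} ×ˢ B) ≤ 1)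
    {D q : ℝ≥0 → ℝ} {J : ℝ≥0 × ℝ → ℝ} {a C d : ℝ} (ha : 0 ≤ a) (hd : 0 ≤ d)
    (hD : IsCadlag D) (hq : ∀ t, 0 ≤ q t) (hqC : ∀ t, q t ≤ C)
    (hDq : ∀ t, IntegrableOn (fun s => D s * q s) (Set.Icc 0 t) lebesgue)
    (hJ : ∀ t, IntegrableOn J (Set.Ioc 0 t ×ˢ B) m)
    (heq : ∀ t, D t = d + a * (∫ s in Set.Icc 0 t, D s * q s ∂lebesgue)
      - ∫ z in Set.Ioc 0 t ×ˢ B, J z ∂m)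
    (hjump : ∀ t b, 0 < t → Tendsto D (𝓝[<] t) (𝓝 b) → 0 ≤ b → ∀ y ∈ B, J (t, y) ≤ b) (t : ℝ≥0) :
    0 ≤ D t := by
  have hC : 0 ≤ C := (hq 0).trans (hqC 0)
  have hDq' : ∀ s t, IntegrableOn (fun s => D s * q s) (Set.Ioc s t) lebesgue := fun s t =>
    (hDq t).mono_set fun r hr => ⟨zero_le, hr.2⟩
  have hinc : ∀ s t, s ≤ t → D t = D s + a * (∫ r in Set.Ioc s t, D r * q r ∂lebesgue)
      - ∫ z in Set.Ioc s t ×ˢ B, J z ∂m := by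
    intro s t hst
    have h1 : Set.Icc 0 t = Set.Icc 0 s ∪ Set.Ioc s t := (Set.Icc_union_Ioc_eq_Icc zero_le hst).symm
    have h2 : Set.Ioc 0 t ×ˢ B = Set.Ioc 0 s ×ˢ B ∪ Set.Ioc s t ×ˢ B := by
      rw [← Set.union_prod, Set.Ioc_union_Ioc_eq_Ioc zero_le hst]
    rw [heq t, heq s, h1, h2, setIntegral_union _ measurableSet_Ioc (hDq s) (hDq' s t),
      setIntegral_union _ (measurableSet_Ioc.prod hB) (hJ s) ((hJ t).mono_set _)]
    · ring
    · exact Set.disjoint_prod.2 (Or.inl (Set.Ioc_disjoint_Ioc_of_le le_rfl))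
    · exact Set.prod_mono (Set.Ioc_subset_Ioc_left zero_le) le_rfl
    · exact Set.disjoint_left.2 fun r hr hr' => not_le.2 hr'.1 hr.2
  have hD0 : 0 ≤ D 0 := by
    rw [heq 0]
    simpa [Measure.restrict_eq_zero.2 (lebesgue_singleton 0)] using hd
  by_contra! hneg
  set S : Set ℝ≥0 := {s | D s < 0} with hS
  have hSne : S.Nonempty := ⟨t, hneg⟩
  set τ := sInf S with hτ
  have hbefore : ∀ s, s < τ → 0 ≤ D s := fun s hs =>
    not_lt.1 fun h => not_le.2 hs (csInf_le (OrderBot.bddBelow S) h)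
  have hDτ : 0 ≤ D τ := by
    rcases eq_zero_or_pos τ with h0 | hpos
    · rwa [h0]
    have : (𝓝[<] τ).NeBot := nhdsLT_neBot_of_exists_lt ⟨0, hpos⟩
    obtain ⟨b, hb⟩ := hD.leftLim τ
    have hb0 : 0 ≤ b := ge_of_tendsto hb (eventually_mem_nhdsWithin.mono hbefore)
    obtain ⟨r, hrτ, hr0⟩ := exists_lt_measure_Ioo_prod_eq_zero hB hint hfin hpos
    have hsing : MeasurableSet ({τ} ×ˢ B : Set (ℝ≥0 × ℝ)) := (measurableSet_singleton τ).prod hB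
    -- The mass of the slice at `τ` is at most `1` and `b ≥ 0`, so the whole jump is at most the
    -- left limit `b`.
    have hJτ : ∫ z in {τ} ×ˢ B, J z ∂m ≤ b := by
      have hlt : m ({τ} ×ˢ B) ≠ ∞ := ne_top_of_le_ne_top ENNReal.one_ne_top (hsimple τ hpos)
      calc ∫ z in {τ} ×ˢ B, J z ∂m ≤ ∫ _ in {τ} ×ˢ B, b ∂m := by
            refine setIntegral_mono_on ((hJ τ).mono_set ?_) (integrableOn_const hlt) hsing ?_
            · exact Set.prod_mono (Set.singleton_subset_iff.2 ⟨hpos, le_rfl⟩) le_rfl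
            · rintro ⟨s, y⟩ ⟨hs, hy⟩
              obtain rfl : s = τ := hs
              exact hjump _ _ hpos hb hb0 y hy
        _ = m.real ({τ} ×ˢ B) * b := by simp
        _ ≤ 1 * b := by
            gcongr
            exact ENNReal.toReal_mono ENNReal.one_ne_top (hsimple τ hpos)
        _ = b := one_mul b
    -- Just before `τ` the only possible claims are those at `τ`, and the premium term is
    -- nonnegative. Letting `s ↑ τ` gives `b ≤ D τ + b`.
    have hev : ∀ᶠ s in 𝓝[<] τ, D s ≤ D τ + b := by
      filter_upwards [Ioo_mem_nhdsLT hrτ] with s hs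
      have h1 : Set.Ioc s τ ×ˢ B = Set.Ioo s τ ×ˢ B ∪ {τ} ×ˢ B := by
        rw [← Set.union_prod, Set.Ioo_union_right hs.2]
      have h2 : m (Set.Ioo s τ ×ˢ B) = 0 :=
        measure_mono_null (Set.prod_mono (Set.Ioo_subset_Ioo_left hs.1.le) le_rfl) hr0
      have h3 : ∫ z in Set.Ioc s τ ×ˢ B, J z ∂m = ∫ z in {τ} ×ˢ B, J z ∂m := by
        rw [h1, Measure.restrict_union' (Set.disjoint_prod.2 (Or.inl (by simp)))
          (measurableSet_Ioo.prod hB), Measure.restrict_eq_zero.2 h2, zero_add]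
      have h4 : 0 ≤ ∫ r in Set.Ioc s τ, D r * q r ∂lebesgue := by
        refine setIntegral_nonneg_of_ae_restrict ?_
        rw [EventuallyLE, ae_restrict_iff' measurableSet_Ioc]
        -- The sign of `D τ` is still unknown, so the endpoint is discarded as a null set.
        have hne : ∀ᵐ r ∂lebesgue, r ≠ τ := by
          simp [ae_iff, lebesgue_singleton]
        filter_upwards [hne] with x hx hxs
        exact mul_nonneg (hbefore x (lt_of_le_of_ne hxs.2 hx)) (hq x)
      have h5 := hinc s τ hs.2.le
      nlinarith [mul_nonneg ha h4]
    linarith [le_of_tendsto hb hev]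
  obtain ⟨r, hτr, hr0⟩ := exists_gt_measure_Ioc_prod_eq_zero hB hint hfin τ
  -- With `D τ ≥ 0` this yields `D > -1` near `τ`, the start of the iteration below.
  have hlow : ∀ᶠ s in 𝓝[≥] τ, D τ - 1 < D s :=
    (hD.rightCts τ).eventually_const_lt (sub_one_lt (D τ))
  have hsmall : ∀ᶠ s : ℝ≥0 in 𝓝[≥] τ, a * C * ((s : ℝ) - τ) < 1 := by
    have hcont : Continuous fun s : ℝ≥0 => a * C * ((s : ℝ) - τ) := by fun_prop
    exact (hcont.tendsto' τ 0 (by simp)).mono_left nhdsWithin_le_nhds |>.eventually_lt_const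
      one_pos
  obtain ⟨e, heτ, he⟩ := mem_nhdsGE_iff_exists_Icc_subset.1 
    ((hlow.and hsmall).and (Icc_mem_nhdsGE hτr))
  have heτ : τ < e := heτ
  set δ := a * C * ((e : ℝ) - τ) with hδ
  have hδ1 : δ < 1 := (he ⟨heτ.le, le_rfl⟩).1.2
  have hδ0 : 0 ≤ δ := mul_nonneg (mul_nonneg ha hC) (sub_nonneg.2 (NNReal.coe_le_coe.2 heτ.le))
  -- Without claims on `(τ, e]`, inserting `D ≥ -M` into the integral equation improves the bound by
  -- the factor `δ < 1`. Iterating replaces the explicit exponential solution.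
  have hstep : ∀ M, 0 ≤ M → (∀ s ∈ Set.Icc τ e, -M ≤ D s) → ∀ s ∈ Set.Icc τ e, -(δ * M) ≤ D s := by
    intro M hM hMD s hs
    have h1 : m (Set.Ioc τ s ×ˢ B) = 0 :=
      measure_mono_null (Set.prod_mono (Set.Ioc_subset_Ioc_right (he hs).2.2) le_rfl) hr0
    have h2 := hinc τ s hs.1
    rw [Measure.restrict_eq_zero.2 h1, integral_zero_measure] at h2
    have hvol : lebesgue.real (Set.Ioc τ s) = (s : ℝ) - τ := by
      rw [measureReal_def, lebesgue_Ioc, ENNReal.toReal_ofReal (sub_nonneg.2 (NNReal.coe_le_coe.2 hs.1))]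
    have h3 : -(M * C * ((s : ℝ) - τ)) ≤ ∫ r in Set.Ioc τ s, D r * q r ∂lebesgue := by
      calc -(M * C * ((s : ℝ) - τ)) = ∫ _ in Set.Ioc τ s, -(M * C) ∂lebesgue := by
            simp [hvol]; ring
        _ ≤ _ := by
          refine setIntegral_mono_on (integrableOn_const (by simp [lebesgue_Ioc])) (hDq' τ s)
            measurableSet_Ioc fun x hx => ?_
          have hx' := hMD x ⟨hx.1.le, hx.2.trans hs.2⟩
          nlinarith [hq x, hqC x, mul_nonneg hM (sub_nonneg.2 (hqC x)),
            mul_nonneg (hq x) (sub_nonneg.2 hx')]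
    have h4 : (s : ℝ) - τ ≤ e - τ := sub_le_sub_right (NNReal.coe_le_coe.2 hs.2) _
    have h5 : M * (a * C * ((s : ℝ) - τ)) ≤ M * δ := by
      rw [hδ]
      gcongr
    have h6 := mul_le_mul_of_nonneg_left h3 ha
    linarith [h2, hDτ]
  have hpow : ∀ n : ℕ, ∀ s ∈ Set.Icc τ e, -(δ ^ n) ≤ D s := by
    intro n
    induction n with
    | zero =>
      intro s hs
      have := (he hs).1.1
      simp only [pow_zero]
      linarith
    | succ n ih =>
      intro s hs
      rw [pow_succ']
      exact hstep _ (pow_nonneg hδ0 n) ih s hs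
  have hnonneg : ∀ s ∈ Set.Icc τ e, 0 ≤ D s := by
    intro s hs
    have hlim := (tendsto_pow_atTop_nhds_zero_of_lt_one hδ0 hδ1).neg
    rw [neg_zero] at hlim
    exact le_of_tendsto' hlim fun n => hpow n s hs
  obtain ⟨s, hs, hse⟩ := exists_lt_of_csInf_lt hSne heτ
  exact absurd (hnonneg s ⟨csInf_le (OrderBot.bddBelow S) hs, hse.le⟩) (not_le.2 hs)

end Path

/-! ### Claims of a Poisson random measure: finite and simple -/

/-- The mass is `1 - exp(-r)(1 + r)`, and `exp(-r) ≥ 1 - r`. The quadratic order in `r` is what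
rules out simultaneous claims. -/
theorem poissonMeasure_two_le (r : ℝ≥0) :
    poissonMeasure r {n | 2 ≤ n} ≤ ENNReal.ofReal ((r : ℝ) ^ 2) := by
  have hcompl : {n : ℕ | 2 ≤ n} = ({0, 1} : Set ℕ)ᶜ := by
    ext n
    simp only [Set.mem_ofPred_eq, Set.mem_compl_iff, Set.mem_insert_iff, Set.mem_singleton_iff]
    omega
  have h01 : (poissonMeasure r).real {0, 1} = Real.exp (-r) * (1 + r) := by
    rw [Set.insert_eq, measureReal_union (by simp) (measurableSet_singleton 1),
      poissonMeasure_real_singleton, poissonMeasure_real_singleton]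
    simp
    ring
  rw [← ofReal_measureReal]
  refine ENNReal.ofReal_le_ofReal ?_
  rw [hcompl, probReal_compl_eq_one_sub (by measurability), h01]
  nlinarith [Real.add_one_le_exp (-(r : ℝ)), r.2, NNReal.coe_nonneg r]

namespace IsPoissonRandomMeasure

variable {Ω E : Type*} [MeasurableSpace Ω] [MeasurableSpace E] {P : Measure Ω}
  {μ : Ω → Measure E} {Λ : Measure E}

theorem measurable_apply (hμ : IsPoissonRandomMeasure P μ Λ) {A : Set E} (hA : MeasurableSet A) :
    Measurable fun ω => μ ω A :=
  (Measure.measurable_coe hA).comp hμ.measurable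

theorem ae_ne_top (hμ : IsPoissonRandomMeasure P μ Λ) {A : Set E} (hA : MeasurableSet A)
    (hΛ : Λ A ≠ ∞) : ∀ᵐ ω ∂P, μ ω A ≠ ∞ := by
  have h : ∀ᵐ c ∂(P.map fun ω => μ ω A), c ≠ ∞ := by
    rw [hμ.law A hA hΛ]
    exact (ae_map_iff (Measurable.of_discrete).aemeasurable (measurableSet_singleton ∞).compl).2
      (ae_of_all _ fun n => ENNReal.natCast_ne_top n)
  exact ae_of_ae_map (hμ.measurable_apply hA).aemeasurable h

theorem measure_two_le (hμ : IsPoissonRandomMeasure P μ Λ) {A : Set E} (hA : MeasurableSet A)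
    (hΛ : Λ A ≠ ∞) : P {ω | 2 ≤ μ ω A} ≤ ENNReal.ofReal ((Λ A).toReal ^ 2) := by
  have h : P {ω | 2 ≤ μ ω A} = P.map (fun ω => μ ω A) (Set.Ici 2) :=
    (Measure.map_apply (hμ.measurable_apply hA) measurableSet_Ici).symm
  rw [h, hμ.law A hA hΛ, Measure.map_apply (by fun_prop) measurableSet_Ici]
  have hset : (fun n : ℕ => (n : ℝ≥0∞)) ⁻¹' Set.Ici 2 = {n | 2 ≤ n} := by
    ext n
    simp only [Set.mem_preimage, Set.mem_Ici, Set.mem_ofPred_eq]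
    exact_mod_cast Iff.rfl
  rw [hset]
  exact poissonMeasure_two_le (Λ A).toNNReal

end IsPoissonRandomMeasure

theorem claimIntensity_Ioc_prod {β : ℝ≥0} {G : Measure ℝ} [IsProbabilityMeasure G] {B : Set ℝ}
    (hB : MeasurableSet B) (hG : G Bᶜ = 0) (s t : ℝ≥0) :
    claimIntensity β G (Set.Ioc s t ×ˢ B) = ENNReal.ofReal ((t - s : ℝ) * β) := by
  have hGB : G B = 1 := (prob_compl_eq_zero_iff hB).1 hG
  rw [claimIntensity, Measure.prod_prod, lebesgue_Ioc, Measure.smul_apply, hGB,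
    ENNReal.ofReal_mul' β.coe_nonneg, ENNReal.ofReal_coe_nnreal, ENNReal.smul_def, smul_eq_mul, mul_one]

section Claims

variable {Ω : Type*} [MeasurableSpace Ω] {P : Measure Ω} {β : ℝ≥0} {G : Measure ℝ}
  [IsProbabilityMeasure G] {B : Set ℝ} {μ : Ω → Measure (ℝ≥0 × ℝ)}

/-- Almost surely there are finitely many claims in bounded time. -/
theorem ae_forall_measure_Ioc_prod_ne_top
    (hμ : IsPoissonRandomMeasure P μ (claimIntensity β G)) (hB : MeasurableSet B)
    (hG : G Bᶜ = 0) : ∀ᵐ ω ∂P, ∀ t, μ ω (Set.Ioc 0 t ×ˢ B) ≠ ∞ := by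
  have h : ∀ᵐ ω ∂P, ∀ n : ℕ, μ ω (Set.Ioc 0 (n : ℝ≥0) ×ˢ B) ≠ ∞ :=
    ae_all_iff.2 fun n => hμ.ae_ne_top (measurableSet_Ioc.prod hB) (by
      rw [claimIntensity_Ioc_prod hB hG]
      exact ENNReal.ofReal_ne_top)
  filter_upwards [h] with ω hω t
  obtain ⟨n, hn⟩ := exists_nat_ge t
  exact ne_top_of_le_ne_top (hω n)
    (measure_mono (Set.prod_mono (Set.Ioc_subset_Ioc_right hn) le_rfl))

/-- Almost surely no two claims occur at the same time. -/
theorem ae_forall_measure_singleton_prod_le_one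
    (hμ : IsPoissonRandomMeasure P μ (claimIntensity β G)) (hB : MeasurableSet B)
    (hG : G Bᶜ = 0) : ∀ᵐ ω ∂P, ∀ t, 0 < t → μ ω ({t} ×ˢ B) ≤ 1 := by
  suffices h : ∀ T : ℕ, ∀ᵐ ω ∂P, ∀ t : ℝ≥0, 0 < t → t ≤ T → μ ω ({t} ×ˢ B) ≤ 1 by
    filter_upwards [ae_all_iff.2 h] with ω hω t ht
    obtain ⟨n, hn⟩ := exists_nat_ge t
    exact hω n t ht hn
  intro T
  -- The interval `(0, T]` is cut into `T * (n + 1)` cells of length `1 / (n + 1)`. A double claim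
  -- puts two points in one cell, which has probability at most `(β / (n + 1))²` per cell; the sum
  -- is of order `1 / (n + 1)`.
  let I : ℕ → ℕ → Set (ℝ≥0 × ℝ) := fun n i =>
    Set.Ioc ((i : ℝ≥0) / (n + 1)) ((i + 1 : ℝ≥0) / (n + 1)) ×ˢ B
  have hIm : ∀ n i, MeasurableSet (I n i) := fun n i => measurableSet_Ioc.prod hB
  have hI : ∀ n i, P {ω | 2 ≤ μ ω (I n i)} ≤ ENNReal.ofReal ((β / (n + 1) : ℝ) ^ 2) := by
    intro n i
    have hΛ : claimIntensity β G (I n i) = ENNReal.ofReal (β / (n + 1)) := by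
      rw [claimIntensity_Ioc_prod hB hG]
      congr 1
      push_cast
      ring
    have h := hμ.measure_two_le (hIm n i) (by rw [hΛ]; exact ENNReal.ofReal_ne_top)
    rwa [hΛ, ENNReal.toReal_ofReal (by positivity)] at h
  have hle : ∀ n : ℕ, P {ω | ¬ ∀ t : ℝ≥0, 0 < t → t ≤ T → μ ω ({t} ×ˢ B) ≤ 1} ≤
      ENNReal.ofReal (T * β ^ 2 * (1 / ((n : ℝ) + 1))) := by
    intro n
    calc P {ω | ¬ ∀ t : ℝ≥0, 0 < t → t ≤ T → μ ω ({t} ×ˢ B) ≤ 1}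
        ≤ P (⋃ i ∈ Finset.range (T * (n + 1)), {ω | 2 ≤ μ ω (I n i)}) := by
          refine measure_mono fun ω hω => ?_
          simp only [Set.mem_ofPred_eq, not_forall, not_le] at hω
          obtain ⟨t, ht0, htT, ht⟩ := hω
          have hn : (0 : ℝ≥0) < n + 1 := by positivity
          have hceil : 0 < ⌈t * (n + 1)⌉₊ := Nat.ceil_pos.2 (mul_pos ht0 hn)
          -- Cells are open on the left and closed on the right, so the index of the cell containing
          -- `t` is the ceiling minus one.
          obtain ⟨i, hi⟩ := Nat.exists_eq_succ_of_ne_zero hceil.ne'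
          have hlow : (i : ℝ≥0) < t * (n + 1) := Nat.lt_ceil.1 (by omega)
          have hup : t * (n + 1) ≤ (i + 1 : ℝ≥0) := by
            have := Nat.le_ceil (t * (n + 1 : ℝ≥0))
            rw [hi] at this
            exact_mod_cast this
          have hiT : i < T * (n + 1) := by
            have : ⌈t * (n + 1)⌉₊ ≤ T * (n + 1) := Nat.ceil_le.2 (by
              push_cast
              gcongr)
            omega
          simp only [Set.mem_iUnion, Finset.mem_range]
          refine ⟨i, hiT, ?_⟩
          have hmem : μ ω ({t} ×ˢ B) ≤ μ ω (I n i) := measure_mono (Set.prod_mono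
            (Set.singleton_subset_iff.2 ⟨(div_lt_iff₀ hn).2 hlow, (le_div_iff₀ hn).2 hup⟩) le_rfl)
          have hlt := ht.trans_le hmem
          obtain ⟨k, hk⟩ := hμ.integerValued ω _ (hIm n i)
          rw [Set.mem_ofPred_eq]
          rw [hk] at hlt ⊢
          have h1 : 1 < k := by exact_mod_cast hlt
          have h2 : 2 ≤ k := by simpa [one_add_one_eq_two] using Order.add_one_le_of_lt h1
          exact_mod_cast h2
      _ ≤ ∑ i ∈ Finset.range (T * (n + 1)), P {ω | 2 ≤ μ ω (I n i)} :=
          measure_biUnion_finset_le _ _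
      _ ≤ ∑ _i ∈ Finset.range (T * (n + 1)), ENNReal.ofReal ((β / (n + 1) : ℝ) ^ 2) :=
          Finset.sum_le_sum fun i _ => hI n i
      _ = ENNReal.ofReal (T * β ^ 2 * (1 / ((n : ℝ) + 1))) := by
          rw [Finset.sum_const, Finset.card_range, ← ENNReal.ofReal_nsmul, nsmul_eq_mul]
          congr 1
          push_cast
          field_simp
  have hlim : Tendsto (fun n : ℕ => ENNReal.ofReal (T * β ^ 2 * (1 / ((n : ℝ) + 1)))) atTop
      (𝓝 0) := by
    rw [← ENNReal.ofReal_zero]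
    refine ENNReal.tendsto_ofReal ?_
    simpa using (tendsto_one_div_add_atTop_nhds_zero_nat (𝕜 := ℝ)).const_mul ((T : ℝ) * β ^ 2)
  exact le_antisymm (ge_of_tendsto' hlim hle) zero_le

end Claims

/-! ### Left limits, premium bounds and the jump estimate -/

theorem IsCadlag.sub {x y : ℝ≥0 → ℝ} (hx : IsCadlag x) (hy : IsCadlag y) :
    IsCadlag fun t => x t - y t where
  rightCts t := (hx.rightCts t).sub (hy.rightCts t)
  leftLim t := by
    obtain ⟨b, hb⟩ := hx.leftLim t
    obtain ⟨c, hc⟩ := hy.leftLim t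
    exact ⟨b - c, hb.sub hc⟩

theorem IsCadlag.tendsto_leftLim {x : ℝ≥0 → ℝ} (hx : IsCadlag x) {t : ℝ≥0} (ht : 0 < t) :
    Tendsto x (𝓝[<] t) (𝓝 (Function.leftLim x t)) := by
  have : (𝓝[<] t).NeBot := nhdsLT_neBot_of_exists_lt ⟨0, ht⟩
  obtain ⟨b, hb⟩ := hx.leftLim t
  rwa [leftLim_eq_of_tendsto hb]

section Premium

variable {β : ℝ≥0} {G : Measure ℝ} {f : ℝ≥0 → ℝ → ℝ≥0} {k₁ k₂ v₀ ζ₀ : ℝ}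

theorem meanClaim_nonneg : 0 ≤ meanClaim G f := integral_nonneg fun y => (f 1 y).2

theorem contractRatio_nonneg (hζ₀ : 0 ≤ ζ₀) : 0 ≤ contractRatio ζ₀ G f :=
  one_div_nonneg.2 (mul_nonneg hζ₀ meanClaim_nonneg)

theorem IsMinimalRetention.premiumRate_nonneg (h : IsMinimalRetention β G f k₁ k₂ v₀) {v : ℝ}
    (hv : v₀ ≤ v) : 0 ≤ premiumRate β G f k₁ k₂ v :=
  (mul_nonneg β.2 (integral_nonneg fun y => (f 1 (min y v)).2)).trans (h.2 v hv)

theorem premiumRate_le (hk₂ : 0 ≤ k₂) (v : ℝ) :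
    premiumRate β G f k₁ k₂ v ≤ (1 + k₁) * β * meanClaim G f := by
  have h : 0 ≤ ∫ y, (f 1 (max (y - v) 0) : ℝ) ∂G := integral_nonneg fun y => (f 1 _).2
  have h' : 0 ≤ (1 + k₂) * β * ∫ y, (f 1 (max (y - v) 0) : ℝ) ∂G := by positivity
  rw [premiumRate]
  linarith

end Premium

/-- The positive part is 1-Lipschitz, so extending `f` by zero to negative fortunes keeps the
Lipschitz constant; `a * K₀ ≤ 1` then bounds the extra claim by the extra fortune, whatever the
signs of `r` and `r'`. -/
theorem IsClaimFunction.sub_le {f : ℝ≥0 → ℝ → ℝ≥0} {K₀ : ℝ≥0} (hf : IsClaimFunction f K₀) {a : ℝ}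
    (ha : 0 ≤ a) (haK : a * K₀ ≤ 1) {r r' y : ℝ} (hr : r ≤ r') (hy : 0 ≤ y) :
    (f (a * r').toNNReal y : ℝ) - f (a * r).toNNReal y ≤ r' - r := by
  have h1 := (hf.lipschitz y hy).dist_le_mul (a * r').toNNReal (a * r).toNNReal
  rw [NNReal.dist_eq, NNReal.dist_eq] at h1
  have h2 : |((a * r').toNNReal : ℝ) - (a * r).toNNReal| ≤ a * (r' - r) := by
    rw [Real.coe_toNNReal', Real.coe_toNNReal']
    refine (abs_max_sub_max_le_abs _ _ _).trans ?_
    rw [← mul_sub, abs_of_nonneg (mul_nonneg ha (sub_nonneg.2 hr))]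
  calc (f (a * r').toNNReal y : ℝ) - f (a * r).toNNReal y
      ≤ K₀ * (a * (r' - r)) := (le_abs_self _).trans (h1.trans (by gcongr))
    _ = a * K₀ * (r' - r) := by ring
    _ ≤ 1 * (r' - r) := by gcongr
    _ = r' - r := one_mul _

end Reinsurance

/-! ### The comparison theorem -/

open Reinsurance in
theorem mainTheorem4 {Ω : Type*} [mΩ : MeasurableSpace Ω] (P : Measure Ω)
    [IsProbabilityMeasure P] [P.IsComplete]
    (B : Set ℝ) (hB : MeasurableSet B) (hBpos : B ⊆ Set.Ioi 0)
    (G : Measure ℝ) [IsProbabilityMeasure G] (hG : G Bᶜ = 0)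
    (β : ℝ≥0) (hβ : 0 < β)
    (μ : Ω → Measure (ℝ≥0 × ℝ)) (hμ : IsPoissonRandomMeasure P μ (claimIntensity β G))
    (f : ℝ≥0 → ℝ → ℝ≥0) (K₀ : ℝ≥0) (hf : IsClaimFunction f K₀)
    (k₁ k₂ : ℝ) (hk₁ : 0 ≤ k₁) (hk₂ : k₁ < k₂) (ζ₀ : ℝ) (hζ₀ : 0 < ζ₀)
    (haK : contractRatio ζ₀ G f * K₀ ≤ 1)
    (v₀ : ℝ) (hv₀ : IsMinimalRetention β G f k₁ k₂ v₀)
    (u l : ℝ≥0 → Ω → ℝ)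
    (hu : IsRetention P (naturalFiltration P μ hμ.measurable) v₀ u)
    (hl : IsCumulative P (naturalFiltration P μ hμ.measurable) l)
    (x x' : ℝ) (hx : 0 ≤ x) (hxx' : x ≤ x') (X X' : ℝ≥0 → Ω → ℝ)
    (hX : IsSolution P (naturalFiltration P μ hμ.measurable) μ B f
      (premiumRate β G f k₁ k₂) (contractRatio ζ₀ G f) x u l X)
    (hX' : IsSolution P (naturalFiltration P μ hμ.measurable) μ B f
      (premiumRate β G f k₁ k₂) (contractRatio ζ₀ G f) x' u l X') :
    ∀ᵐ ω ∂P, ∀ t, X t ω ≤ X' t ω := by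
  have ha := contractRatio_nonneg (G := G) (f := f) hζ₀.le
  set a := contractRatio ζ₀ G f
  filter_upwards [ae_forall_measure_Ioc_prod_ne_top hμ hB hG,
    ae_forall_measure_singleton_prod_le_one hμ hB hG, hu.ge,
    hX.cadlag, hX'.cadlag, hX.integrable_premium, hX'.integrable_premium,
    hX.integrable_claims, hX'.integrable_claims, hX.equation, hX'.equation]
    with ω hfin hsimple huge hc hc' hp hp' hj hj' he he' t
  rw [← sub_nonneg]
  refine nonneg_of_linear_of_jump_le (m := μ ω) (a := a) (d := x' - x)
    (C := (1 + k₁) * β * meanClaim G f) (D := fun t => X' t ω - X t ω)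
    (q := fun t => premiumRate β G f k₁ k₂ (u t ω))
    (J := fun z => claimSize a f (fun s => X' s ω) (fun s => u s ω) z -
      claimSize a f (fun s => X s ω) (fun s => u s ω) z)
    hB (hμ.integerValued ω) hfin hsimple ha (sub_nonneg.2 hxx') (hc'.sub hc)
    (fun t => hv₀.premiumRate_nonneg (huge t)) (fun t => premiumRate_le (hk₁.trans hk₂.le) _)
    (fun t => ?_) (fun t => (hj' t).sub (hj t)) (fun t => ?_) (fun t b ht hb hb0 y hy => ?_) t
  · simp only [sub_mul]
    exact (hp' t).sub (hp t)
  · simp only [sub_mul]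
    rw [integral_sub (hp' t) (hp t), integral_sub (hj' t) (hj t), he t, he' t]
    ring
  · have : (𝓝[<] t).NeBot := nhdsLT_neBot_of_exists_lt ⟨0, ht⟩
    -- The left limit of the difference is the difference of the left limits, so `0 ≤ b` says that
    -- the two left limits are ordered, as the jump estimate needs.
    have hbt := tendsto_nhds_unique hb ((hc'.tendsto_leftLim ht).sub (hc.tendsto_leftLim ht))
    rw [hbt] at hb0 ⊢
    exact hf.sub_le ha haK (sub_nonneg.1 hb0)
      (le_min (hBpos hy).le (hv₀.1.le.trans (huge t)))
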